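/- Let $(V_1,V_2)$ be a random vector in $\mathbb{R}^2$ whose marginals $V_1$ and $V_2$ are uniform on $[0,1]$ and which has a probability density function $c$ with respect to Lebesgue measure. Assume that $c$ is weakly differentiable on the open square $(0,1)^2$, with weak gradient $\nabla c$; that is, $\nabla c=(\partial_1 c,\partial_2 c)$ is locally integrable on $(0,1)^2$ and $\int_{(0,1)^2} c\,\partial_i\varphi\,dx = -\int_{(0,1)^2} (\partial_i c)\,\varphi\,dx$ for $i=1,2$ and every $\varphi\in C_c^\infty((0,1)^2)$ (for instance, $c$ may be continuously differentiable on $(0,1)^2$). Let $U_1,U_2$ be independent random variables, each uniform on $[0,1]$. Then $$d_{\mathcal W}\big((V_1,V_2),(U_1,U_2)\big)\;\le\;\frac{2}{\pi^2}\left(\int_{[0,1]^2}|\nabla c(x_1,x_2)|^2\,dx_1\,dx_2\right)^{1/2},$$ where the right-hand side may be $+\infty$, $|\cdot|$ is the Euclidean norm, and $d_{\mathcal W}(X,Y)=\sup_h|\mathbb{E}\,h(X)-\mathbb{E}\,h(Y)|$ is the 1-Wasserstein distance, the supremum being over all functions $h:\mathbb{R}^2\to\mathbb{R}$ with $|h(x)-h(y)|\le|x-y|$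 for all $x,y$. -/

import Mathlib

open MeasureTheory ProbabilityTheory Set
open scoped ENNReal

noncomputable section

namespace CopulaStein

open scoped ContDiff

/-- The 1-Wasserstein distance between two laws `μ`, `ν` (with finite first moments) on `ℝ^d` with
its Euclidean norm: the supremum of `|∫ h dμ - ∫ h dν|` over all `1`-Lipschitz `h : ℝ^d → ℝ`. -/
def wassersteinDist {d : ℕ} (μ ν : Measure (EuclideanSpace ℝ (Fin d))) : ℝ≥0∞ :=
  ⨆ (h : EuclideanSpace ℝ (Fin d) → ℝ) (_ : LipschitzWith 1 h),
    ENNReal.ofReal |∫ x, h x ∂μ - ∫ x, h x ∂ν|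

/-- `G` is the weak (distributional) gradient of `f` on the open set `U ⊆ ℝ^d`: both are locally
integrable on `U`, and `∫_U f ∂ᵢφ = - ∫_U Gᵢ φ` for every test function `φ ∈ C_c^∞(U)` and
every coordinate `i`. -/
structure HasWeakGradientOn {d : ℕ} (f : EuclideanSpace ℝ (Fin d) → ℝ)
    (G : EuclideanSpace ℝ (Fin d) → EuclideanSpace ℝ (Fin d))
    (U : Set (EuclideanSpace ℝ (Fin d))) : Prop where
  locallyIntegrableOn : LocallyIntegrableOn f U volume
  locallyIntegrableOn_gradient : LocallyIntegrableOn G U volume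
  integral_eq : ∀ φ : EuclideanSpace ℝ (Fin d) → ℝ,
    ContDiff ℝ ∞ φ → HasCompactSupport φ → tsupport φ ⊆ U →
    ∀ i : Fin d, ∫ x in U, f x * fderiv ℝ φ x (EuclideanSpace.single i 1) =
      - ∫ x in U, G x i * φ x

/-- The closed unit square `[0,1]²`. -/
def closedUnitSquare : Set (EuclideanSpace ℝ (Fin 2)) := {x | ∀ i, x i ∈ Icc (0 : ℝ) 1}

/-- The open unit square `(0,1)²`. -/
def openUnitSquare : Set (EuclideanSpace ℝ (Fin 2)) := {x | ∀ i, x i ∈ Ioo (0 : ℝ) 1}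

/-- `c` is a probability density function, with respect to Lebesgue measure, of the random vector
`X` in `ℝ^d` under `P`. -/
structure IsDensityOf {Ω : Type*} [MeasurableSpace Ω] {d : ℕ}
    (c : EuclideanSpace ℝ (Fin d) → ℝ) (X : Ω → EuclideanSpace ℝ (Fin d)) (P : Measure Ω) :
    Prop where
  aemeasurable : AEMeasurable c volume
  nonneg : ∀ᵐ x, 0 ≤ c x
  map_eq : P.map X = volume.withDensity (fun x => ENNReal.ofReal (c x))

end CopulaStein

end

/-! Fix a 1-Lipschitz `h` and average out its first variable: `m(y) = ∫₀¹ h(s,y) ds`. Independence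
gives `E h(U) = ∫₀¹ m`, and this equals `E m(V₂)` because `V₂` is uniform too. Hence the difference
of expectations is `∫ c (h - m)`, where `h - m` has mean zero in the first variable. Its primitive
`F(x,y) = ∫₀ˣ (h - m)` vanishes at `x = 0` and `x = 1`, so integration by parts gives `-∫ ∂₁c · F`
without boundary terms. Since `|F| ≤ 1/8` (`abs_integral_sub_mean_le`), Cauchy-Schwarz on a square
of area 1 (`lintegral_partial_le`) bounds this by `1/8` times the `L²` norm of the gradient, and
`1/8 ≤ 2/π²`. Only the first partial derivative enters.

The technical point is that `F` is merely continuous in `y` and need not have compact support in the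
open square. Mollification admits test functions with a single continuous partial derivative
(`HasWeakGradientOn.integral_eq_of_hasLineDerivAt`); cutoffs that preserve the mean-zero condition
then remove the support condition (`HasWeakGradientOn.integral_primitive`). -/

namespace CopulaStein

open Filter Topology Metric
open scoped Convolution ContDiff

/-! ### Mollification and a larger class of test functions -/

section Mollification

variable {E : Type*} [NormedAddCommGroup E] [NormedSpace ℝ E] [FiniteDimensional ℝ E]
  [MeasurableSpace E] [BorelSpace E] {μ : Measure E} [μ.IsAddHaarMeasure]

/-- A convolution with a smooth compactly supported kernel is differentiated in a direction by
differentiating the other factor, when that factor has a continuous derivative in this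
direction. -/
theorem fderiv_convolution_apply_of_hasLineDerivAt {ρ φ φ' : E → ℝ} {v : E}
    (hρ : ContDiff ℝ ∞ ρ) (hρc : HasCompactSupport ρ) (hφ : Continuous φ) (hφ' : Continuous φ')
    (h : ∀ x, HasLineDerivAt ℝ φ (φ' x) x v) (x : E) :
    fderiv ℝ (ρ ⋆[ContinuousLinearMap.lsmul ℝ ℝ, μ] φ) x v =
      (ρ ⋆[ContinuousLinearMap.lsmul ℝ ℝ, μ] φ') x := by
  -- Smoothness of `ρ` already makes the convolution differentiable, so it suffices to compute its
  -- derivative along one line, under the integral sign.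
  have hd := (hρc.contDiff_convolution_left (ContinuousLinearMap.lsmul ℝ ℝ) hρ
    (hφ.locallyIntegrable (μ := μ))).differentiable (by simp) x
  rw [← hd.lineDeriv_eq_fderiv]
  refine HasLineDerivAt.lineDeriv ?_
  unfold HasLineDerivAt
  have hline : ∀ (y : E) (t : ℝ),
      HasDerivAt (fun s : ℝ => φ (y + s • v)) (φ' (y + t • v)) t := by
    intro y t
    have := h (y + t • v)
    unfold HasLineDerivAt at this
    have h0 : HasDerivAt (fun s : ℝ => φ (y + t • v + s • v)) (φ' (y + t • v)) (t - t) := by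
      simpa using this
    have := h0.comp_sub_const t t
    refine this.congr_of_eventuallyEq (Eventually.of_forall fun s => ?_)
    simp only
    congr 1
    module
  -- a bound for `φ'` on the compact set of points that matter
  obtain ⟨C, hC⟩ : ∃ C, ∀ y ∈ tsupport ρ, ∀ s ∈ closedBall (0 : ℝ) 1,
      ‖φ' (x + s • v - y)‖ ≤ C := by
    have hk : IsCompact (tsupport ρ ×ˢ closedBall (0 : ℝ) 1) :=
      hρc.isCompact.prod (isCompact_closedBall _ _)
    obtain ⟨C, hC⟩ := hk.exists_bound_of_continuousOn
      (f := fun p : E × ℝ => φ' (x + p.2 • v - p.1)) (by fun_prop)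
    exact ⟨C, fun y hy s hs => hC (y, s) ⟨hy, hs⟩⟩
  have key := hasDerivAt_integral_of_dominated_loc_of_deriv_le (μ := μ)
    (F := fun (s : ℝ) (y : E) => ρ y * φ (x + s • v - y))
    (F' := fun (s : ℝ) (y : E) => ρ y * φ' (x + s • v - y)) (x₀ := 0)
    (s := closedBall (0 : ℝ) 1) (bound := fun y => ‖ρ y‖ * C)
    (closedBall_mem_nhds _ one_pos)
    (Eventually.of_forall fun s => by
      have := hρ.continuous
      exact Continuous.aestronglyMeasurable (by fun_prop))
    (by
      have := hρ.continuous
      refine Continuous.integrable_of_hasCompactSupport (by fun_prop) ?_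
      exact hρc.mul_right)
    (by
      have := hρ.continuous
      exact Continuous.aestronglyMeasurable (by fun_prop))
    (Eventually.of_forall fun y s hs => by
      rw [norm_mul]
      by_cases hy : y ∈ tsupport ρ
      · gcongr
        exact hC y hy s hs
      · simp [image_eq_zero_of_notMem_tsupport hy])
    (((hρ.continuous.integrable_of_hasCompactSupport hρc).norm).mul_const C)
    (Eventually.of_forall fun y s _ => by
      have := (hline (x - y) s).const_mul (ρ y)
      convert! this using 2
      · rename_i t
        congr 2
        abel
      · congr 1
        abel)
  simpa [convolution_def] using key.2

end Mollification

/-- The defining identity of the weak gradient extends from smooth test functions to continuous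
compactly supported functions with a continuous partial derivative. -/
theorem HasWeakGradientOn.integral_eq_of_hasLineDerivAt {d : ℕ}
    {c : EuclideanSpace ℝ (Fin d) → ℝ} {G : EuclideanSpace ℝ (Fin d) → EuclideanSpace ℝ (Fin d)}
    {U : Set (EuclideanSpace ℝ (Fin d))} (hG : HasWeakGradientOn c G U) (hU : IsOpen U) (i : Fin d)
    (hc : IntegrableOn c U) (hGi : IntegrableOn (fun x => G x i) U)
    {φ φ' : EuclideanSpace ℝ (Fin d) → ℝ} (hφ : Continuous φ) (hφ' : Continuous φ')
    (hφc : HasCompactSupport φ) (hφU : tsupport φ ⊆ U)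
    (hd : ∀ x, HasLineDerivAt ℝ φ (φ' x) x (EuclideanSpace.single i 1)) :
    ∫ x in U, c x * φ' x = - ∫ x in U, G x i * φ x := by
  have hφ'c : HasCompactSupport φ' := by
    refine hφc.mono' fun x hx => ?_
    by_contra hxn
    refine hx ((hd x).unique ?_)
    have h0 : φ =ᶠ[𝓝 x] fun _ => 0 := notMem_tsupport_iff_eventuallyEq.1 hxn
    exact ((hasFDerivAt_const (0 : ℝ) x).hasLineDerivAt
      (EuclideanSpace.single i (1 : ℝ))).congr_of_eventuallyEq h0
  obtain ⟨δ₀, hδ₀, hδ₀U⟩ := hφc.isCompact.exists_cthickening_subset_open hU hφU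
  have hu := hφc.uniformContinuous_of_continuous hφ
  have hu' := hφ'c.uniformContinuous_of_continuous hφ'
  set A := (∫ x in U, ‖c x‖) + ∫ x in U, ‖G x i‖ with hA
  have hmain : ∀ ε > 0, |(∫ x in U, c x * φ' x) + ∫ x in U, G x i * φ x| ≤ ε * A := by
    intro ε hε
    obtain ⟨δ₁, hδ₁, h1⟩ := Metric.uniformContinuous_iff.1 hu ε hε
    obtain ⟨δ₂, hδ₂, h2⟩ := Metric.uniformContinuous_iff.1 hu' ε hε
    -- `δ₀` keeps the support of the mollified function inside `U`; `δ₁` and `δ₂` make the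
    -- mollifications uniformly `ε`-close to `φ` and `φ'`.
    set δ := min δ₀ (min δ₁ δ₂)
    have hδpos : 0 < δ := by positivity
    let b : ContDiffBump (0 : EuclideanSpace ℝ (Fin d)) := ⟨δ / 2, δ, by positivity, by linarith⟩
    set ρ := b.normed volume
    have hρ : ContDiff ℝ ∞ ρ := b.contDiff_normed
    have hρc : HasCompactSupport ρ := b.hasCompactSupport_normed
    set ψ := ρ ⋆[ContinuousLinearMap.lsmul ℝ ℝ, volume] φ with hψ
    set ψ' := ρ ⋆[ContinuousLinearMap.lsmul ℝ ℝ, volume] φ'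
    have hψd : ContDiff ℝ ∞ ψ :=
      hρc.contDiff_convolution_left _ hρ hφ.locallyIntegrable
    have hψ'd : ContDiff ℝ ∞ ψ' :=
      hρc.contDiff_convolution_left _ hρ hφ'.locallyIntegrable
    have hsub : tsupport ψ ⊆ cthickening δ (tsupport φ) := by
      refine closure_minimal ?_ isClosed_cthickening
      refine (support_convolution_subset _).trans ?_
      rintro _ ⟨y, hy, z, hz, rfl⟩
      refine thickening_subset_cthickening _ _ ?_
      rw [mem_thickening_iff]
      refine ⟨z, subset_tsupport _ hz, ?_⟩
      have : y ∈ ball (0 : EuclideanSpace ℝ (Fin d)) δ := by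
        rw [← b.support_normed_eq (μ := volume)]; exact hy
      simpa using this
    have hψc : HasCompactSupport ψ :=
      hφc.isCompact.cthickening.of_isClosed_subset (isClosed_tsupport _) hsub
    have hψU : tsupport ψ ⊆ U :=
      hsub.trans ((cthickening_mono (min_le_left _ _) _).trans hδ₀U)
    have hI := hG.integral_eq ψ hψd hψc hψU i
    have hI' : ∫ x in U, c x * ψ' x = - ∫ x in U, G x i * ψ x := by
      rw [← hI]
      congr 1
      ext x
      rw [hψ, fderiv_convolution_apply_of_hasLineDerivAt hρ hρc hφ hφ' hd]
    have e1 : ∀ x, ‖φ x - ψ x‖ ≤ ε := fun x => by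
      rw [← dist_eq_norm, dist_comm]
      refine b.dist_normed_convolution_le hφ.aestronglyMeasurable fun y hy => (h1 ?_).le
      exact (mem_ball.1 hy).trans_le ((min_le_right _ _).trans (min_le_left _ _))
    have e2 : ∀ x, ‖φ' x - ψ' x‖ ≤ ε := fun x => by
      rw [← dist_eq_norm, dist_comm]
      refine b.dist_normed_convolution_le hφ'.aestronglyMeasurable fun y hy => (h2 ?_).le
      exact (mem_ball.1 hy).trans_le ((min_le_right _ _).trans (min_le_right _ _))
    have hψ'c : HasCompactSupport ψ' := hρc.convolution _ hφ'c
    have int : ∀ {w g : EuclideanSpace ℝ (Fin d) → ℝ}, IntegrableOn w U → Continuous g →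
        HasCompactSupport g → IntegrableOn (fun x => w x * g x) U := by
      intro w g hw hg hgc
      obtain ⟨M, hM⟩ := hg.bounded_above_of_compact_support hgc
      exact Integrable.mul_bdd (c := M) hw hg.aestronglyMeasurable (Eventually.of_forall hM)
    have est : ∀ {w g g' : EuclideanSpace ℝ (Fin d) → ℝ}, IntegrableOn w U → Continuous g →
        HasCompactSupport g → Continuous g' → HasCompactSupport g' → (∀ x, ‖g x - g' x‖ ≤ ε) →
        |(∫ x in U, w x * g x) - ∫ x in U, w x * g' x| ≤ ε * ∫ x in U, ‖w x‖ := by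
      intro w g g' hw hg hgc hg' hgc' hgg
      rw [← integral_sub (int hw hg hgc) (int hw hg' hgc'), ← integral_const_mul, ← Real.norm_eq_abs]
      refine norm_integral_le_of_norm_le (hw.norm.const_mul ε) (Eventually.of_forall fun x => ?_)
      rw [← mul_sub, norm_mul, mul_comm]
      gcongr
      exact hgg x
    have E1 := est hc hφ' hφ'c hψ'd.continuous hψ'c e2
    have E2 := est hGi hφ hφc hψd.continuous hψc e1
    calc |(∫ x in U, c x * φ' x) + ∫ x in U, G x i * φ x|
        = |((∫ x in U, c x * φ' x) - ∫ x in U, c x * ψ' x)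
          + ((∫ x in U, G x i * φ x) - ∫ x in U, G x i * ψ x)| := by rw [hI']; ring_nf
      _ ≤ _ := abs_add_le _ _
      _ ≤ ε * A := by rw [hA, mul_add]; exact add_le_add E1 E2
  have hlim : |(∫ x in U, c x * φ' x) + ∫ x in U, G x i * φ x| ≤ 0 := by
    have ht : Tendsto (fun ε : ℝ => ε * A) (𝓝[>] 0) (𝓝 0) := by
      have : Tendsto (fun ε : ℝ => ε * A) (𝓝 0) (𝓝 (0 * A)) := tendsto_id.mul_const A
      rw [zero_mul] at this
      exact this.mono_left nhdsWithin_le_nhds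
    exact ge_of_tendsto ht (eventually_mem_nhdsWithin.mono hmain)
  have := abs_nonpos_iff.1 hlim
  linarith

end CopulaStein

/-! ### Integration by parts against primitives on the square -/

namespace CopulaStein

open Filter Topology

theorem isOpen_openUnitSquare : IsOpen openUnitSquare := by
  simp only [openUnitSquare, ofPred_forall]
  exact isOpen_iInter_of_finite fun i => isOpen_Ioo.preimage (by fun_prop)

theorem isCompact_setOf_forall_mem_Icc (d : ℕ) (a b : ℝ) :
    IsCompact {x : EuclideanSpace ℝ (Fin d) | ∀ i, x i ∈ Icc a b} := by
  have h : IsCompact (Set.univ.pi fun _ : Fin d => Icc a b) :=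
    isCompact_univ_pi fun _ => isCompact_Icc
  convert! (EuclideanSpace.equiv (Fin d) ℝ).toHomeomorph.isCompact_preimage.2 h using 1
  ext x
  rw [mem_preimage, mem_univ_pi]
  exact forall_congr' fun i => by simp

section Primitive

variable {c : EuclideanSpace ℝ (Fin 2) → ℝ}
  {G : EuclideanSpace ℝ (Fin 2) → EuclideanSpace ℝ (Fin 2)}

/-- The primitive has support in a compact subsquare: it is zero before `f` starts, and the
mean-zero condition makes it zero again once `f` has stopped. Along the first axis its derivative is
`f`; in the second variable it is only continuous, hence the need for the larger class of test
functions. -/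
theorem HasWeakGradientOn.integral_primitive_of_support (hG : HasWeakGradientOn c G openUnitSquare)
    (hc : IntegrableOn c openUnitSquare) (hG0 : IntegrableOn (fun x => G x 0) openUnitSquare)
    {f : ℝ → ℝ → ℝ} (hf : Continuous fun p : ℝ × ℝ => f p.1 p.2)
    (hmean : ∀ y, ∫ s in (0 : ℝ)..1, f s y = 0) {δ : ℝ} (hδ : 0 < δ)
    (hsupp : ∀ s y, f s y ≠ 0 → s ∈ Icc δ (1 - δ) ∧ y ∈ Icc δ (1 - δ)) :
    ∫ x in openUnitSquare, c x * f (x 0) (x 1) =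
      - ∫ x in openUnitSquare, G x 0 * ∫ s in (0 : ℝ)..x 0, f s (x 1) := by
  have hfx : ∀ y, Continuous fun s => f s y := fun y =>
    hf.comp (f := fun s : ℝ => (s, y)) (by fun_prop)
  have hcont : Continuous fun x : EuclideanSpace ℝ (Fin 2) => ∫ s in (0 : ℝ)..x 0, f s (x 1) :=
    intervalIntegral.continuous_parametric_intervalIntegral_of_continuous
      (f := fun (x : EuclideanSpace ℝ (Fin 2)) s => f s (x 1)) (s := fun x => x 0)
      (hf.comp (f := fun p : EuclideanSpace ℝ (Fin 2) × ℝ => (p.2, p.1 1)) (by fun_prop))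
      (by fun_prop)
  have hsub : tsupport (fun x : EuclideanSpace ℝ (Fin 2) => ∫ s in (0 : ℝ)..x 0, f s (x 1)) ⊆
      {x | ∀ i, x i ∈ Icc δ (1 - δ)} := by
    refine closure_minimal (fun x hx => ?_) (isCompact_setOf_forall_mem_Icc 2 _ _).isClosed
    rw [Function.mem_support] at hx
    have h1 : x 1 ∈ Icc δ (1 - δ) := by
      by_contra hn
      refine hx ?_
      have : ∀ s, f s (x 1) = 0 := fun s => by
        by_contra h
        exact hn (hsupp s _ h).2
      simp [this]
    have h0 : x 0 ∈ Icc δ (1 - δ) := by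
      by_contra hn
      refine hx ?_
      rcases lt_or_ge (x 0) δ with h | h
      · refine intervalIntegral.integral_zero_ae (Eventually.of_forall fun s hs => ?_)
        by_contra hne
        have h2 := (hsupp s _ hne).1.1
        have h3 := (uIoc_subset_uIcc hs).2
        rcases max_choice 0 (x 0) with h4 | h4 <;> rw [h4] at h3 <;> linarith
      · have h' : 1 - δ < x 0 := by
          by_contra h'
          exact hn ⟨h, not_lt.1 h'⟩
        -- Split at 1: the integral over `[0,1]` is the vanishing mean, and `f` is zero between 1
        -- and `x 0`.
        rw [← intervalIntegral.integral_add_adjacent_intervals (b := 1)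
          ((hfx _).intervalIntegrable _ _) ((hfx _).intervalIntegrable _ _), hmean, zero_add]
        refine intervalIntegral.integral_zero_ae (Eventually.of_forall fun s hs => ?_)
        by_contra hne
        have h2 := (hsupp s _ hne).1.2
        have h3 := (uIoc_subset_uIcc hs).1
        rcases min_choice 1 (x 0) with h4 | h4 <;> rw [h4] at h3 <;> linarith
    intro i
    fin_cases i
    exacts [h0, h1]
  refine hG.integral_eq_of_hasLineDerivAt isOpen_openUnitSquare 0 hc hG0 hcont
    (φ' := fun x => f (x 0) (x 1)) (hf.comp (f := fun x : EuclideanSpace ℝ (Fin 2) => (x 0, x 1))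
      (by fun_prop)) ?_ (hsub.trans fun x hx i => ?_) fun x => ?_
  · exact (isCompact_setOf_forall_mem_Icc 2 _ _).of_isClosed_subset (isClosed_tsupport _) hsub
  · exact ⟨hδ.trans_le (hx i).1, (hx i).2.trans_lt (by linarith)⟩
  · unfold HasLineDerivAt
    have h := intervalIntegral.integral_hasDerivAt_right
      ((hfx (x 1)).intervalIntegrable 0 (x 0 + 0)) ((hfx (x 1)).stronglyMeasurableAtFilter _ _)
      (hfx (x 1)).continuousAt
    have := h.comp_const_add (x 0) 0
    simpa using this

/-- A continuous cutoff function, supported away from the endpoints of `[0,1]`. -/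
def cutoff (n : ℕ) (t : ℝ) : ℝ := max 0 (min 1 ((n + 3) * min t (1 - t) - 1))

theorem continuous_cutoff (n : ℕ) : Continuous (cutoff n) := by
  unfold cutoff; fun_prop

theorem cutoff_nonneg (n : ℕ) (t : ℝ) : 0 ≤ cutoff n t := le_max_left _ _

theorem cutoff_le_one (n : ℕ) (t : ℝ) : cutoff n t ≤ 1 :=
  max_le zero_le_one (min_le_left _ _)

theorem mem_Icc_of_cutoff_ne_zero {n : ℕ} {t : ℝ} (h : cutoff n t ≠ 0) :
    t ∈ Icc (1 / ((n : ℝ) + 3)) (1 - 1 / ((n : ℝ) + 3)) := by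
  have hn : (0 : ℝ) < n + 3 := by positivity
  have h1 : 0 < (n + 3) * min t (1 - t) - 1 := by
    by_contra hn
    exact h (max_eq_left ((min_le_right _ _).trans (not_lt.1 hn)))
  have h2 : 1 / ((n : ℝ) + 3) < min t (1 - t) := by
    rw [div_lt_iff₀ hn]; linarith
  have h3 := lt_min_iff.1 h2
  exact ⟨h3.1.le, by linarith [h3.2]⟩

theorem tendsto_cutoff {t : ℝ} (ht : t ∈ Ioo (0 : ℝ) 1) :
    Tendsto (fun n => cutoff n t) atTop (𝓝 1) := by
  have hm : 0 < min t (1 - t) := lt_min ht.1 (by linarith [ht.2])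
  refine tendsto_const_nhds.congr' ?_
  have h1 : Tendsto (fun n : ℕ => ((n : ℝ) + 3) * min t (1 - t) - 1) atTop atTop :=
    tendsto_atTop_add_const_right _ _ ((tendsto_atTop_add_const_right _ _
      tendsto_natCast_atTop_atTop).atTop_mul_const hm)
  filter_upwards [h1.eventually_ge_atTop 1] with n hn
  simp [cutoff, min_eq_left hn]

theorem integral_cutoff_pos (n : ℕ) : 0 < ∫ s in (0 : ℝ)..1, cutoff n s := by
  refine intervalIntegral.integral_pos zero_lt_one (continuous_cutoff n).continuousOn
    (fun s _ => cutoff_nonneg n s) ⟨1 / 2, by norm_num, ?_⟩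
  -- At `1/2` the slope `n + 3` gives `(n + 3) / 2 - 1`, positive already for `n = 0`; a slope of `n
  -- + 2` would give zero there.
  refine lt_max_of_lt_right (lt_min one_pos ?_)
  have : (0 : ℝ) ≤ n := n.cast_nonneg
  norm_num
  linarith

/-- Dominated convergence on subintervals of `[0,1]`. -/
theorem tendsto_intervalIntegral_of_bounded {g : ℕ → ℝ → ℝ} {g₀ : ℝ → ℝ} {M a : ℝ}
    (ha : a ∈ Icc (0 : ℝ) 1) (hg : ∀ n, Continuous (g n))
    (hb : ∀ n, ∀ s ∈ Icc (0 : ℝ) 1, |g n s| ≤ M)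
    (ht : ∀ s ∈ Ioo (0 : ℝ) 1, Tendsto (fun n => g n s) atTop (𝓝 (g₀ s))) :
    Tendsto (fun n => ∫ s in (0 : ℝ)..a, g n s) atTop (𝓝 (∫ s in (0 : ℝ)..a, g₀ s)) := by
  refine intervalIntegral.tendsto_integral_filter_of_dominated_convergence (fun _ => M)
    (Eventually.of_forall fun n => (hg n).aestronglyMeasurable)
    (Eventually.of_forall fun n => Eventually.of_forall fun s hs => ?_)
    intervalIntegrable_const ?_
  · rw [uIoc_of_le ha.1] at hs
    exact hb n s ⟨hs.1.le, hs.2.trans ha.2⟩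
  · have h1 : ∀ᵐ s : ℝ, s ≠ 1 := by simp [ae_iff]
    filter_upwards [h1] with s hs1 hs
    rw [uIoc_of_le ha.1] at hs
    exact ht s ⟨hs.1, lt_of_le_of_ne (hs.2.trans ha.2) hs1⟩

/-- If `f` is continuous and has mean zero in the first variable, its primitive in the first
variable may be used as a test function in the definition of the first weak partial derivative,
with no condition at the boundary of the square. -/
theorem HasWeakGradientOn.integral_primitive (hG : HasWeakGradientOn c G openUnitSquare)
    (hc : IntegrableOn c openUnitSquare) (hG0 : IntegrableOn (fun x => G x 0) openUnitSquare)
    {f : ℝ → ℝ → ℝ} (hf : Continuous fun p : ℝ × ℝ => f p.1 p.2)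
    (hmean : ∀ y, ∫ s in (0 : ℝ)..1, f s y = 0) :
    ∫ x in openUnitSquare, c x * f (x 0) (x 1) =
      - ∫ x in openUnitSquare, G x 0 * ∫ s in (0 : ℝ)..x 0, f s (x 1) := by
  have hfx : ∀ y, Continuous fun s => f s y := fun y =>
    hf.comp (f := fun s : ℝ => (s, y)) (by fun_prop)
  obtain ⟨M, hM⟩ : ∃ M, ∀ s ∈ Icc (0 : ℝ) 1, ∀ y ∈ Icc (0 : ℝ) 1, |f s y| ≤ M := by
    obtain ⟨M, hM⟩ := (isCompact_Icc.prod isCompact_Icc).exists_bound_of_continuousOn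
      (s := Icc (0 : ℝ) 1 ×ˢ Icc (0 : ℝ) 1) hf.continuousOn
    exact ⟨M, fun s hs y hy => hM (s, y) ⟨hs, hy⟩⟩
  set W : ℕ → ℝ := fun n => ∫ s in (0 : ℝ)..1, cutoff n s with hW
  -- Cutting off `f` in `s` spoils its mean, so the cutoff-weighted mean `m n y` is subtracted
  -- first. It tends to the mean of `f`, which is zero, so the correction disappears in the limit.
  set m : ℕ → ℝ → ℝ := fun n y => (∫ s in (0 : ℝ)..1, cutoff n s * f s y) / W n with hm
  set g : ℕ → ℝ → ℝ → ℝ := fun n s y => cutoff n y * (cutoff n s * (f s y - m n y)) with hg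
  have hWpos : ∀ n, 0 < W n := integral_cutoff_pos
  have hmc : ∀ n, Continuous (m n) := fun n => by
    refine Continuous.div_const ?_ _
    refine intervalIntegral.continuous_parametric_intervalIntegral_of_continuous'
      (f := fun y s => cutoff n s * f s y) ?_ 0 1
    have := continuous_cutoff n
    have h2 : Continuous fun p : ℝ × ℝ => f p.2 p.1 := hf.comp continuous_swap
    exact (this.comp continuous_snd).mul h2
  have hgc : ∀ n, Continuous fun p : ℝ × ℝ => g n p.1 p.2 := fun n => by
    have := continuous_cutoff n
    have := hmc n
    simp only [hg]
    fun_prop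
  have hgx : ∀ n y, Continuous fun s => g n s y := fun n y =>
    (hgc n).comp (f := fun s : ℝ => (s, y)) (by fun_prop)
  have hgmean : ∀ n y, ∫ s in (0 : ℝ)..1, g n s y = 0 := by
    intro n y
    have h1 : IntervalIntegrable (fun s => cutoff n s * f s y) volume 0 1 :=
      ((continuous_cutoff n).mul (hfx y)).intervalIntegrable 0 1
    have h2 := ((continuous_cutoff n).intervalIntegrable (μ := volume) 0 1).mul_const (m n y)
    simp only [hg]
    rw [intervalIntegral.integral_const_mul]
    simp only [mul_sub]
    rw [intervalIntegral.integral_sub h1 h2, intervalIntegral.integral_mul_const]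
    have : (∫ s in (0 : ℝ)..1, cutoff n s) * m n y = ∫ s in (0 : ℝ)..1, cutoff n s * f s y := by
      simp only [hm]
      rw [mul_div_cancel₀ _ (hWpos n).ne']
    rw [this]
    simp
  have hmb : ∀ n, ∀ y ∈ Icc (0 : ℝ) 1, |m n y| ≤ M := by
    intro n y hy
    simp only [hm]
    rw [abs_div, abs_of_pos (hWpos n), div_le_iff₀ (hWpos n)]
    simp only [hW]
    rw [← intervalIntegral.integral_const_mul, ← Real.norm_eq_abs]
    refine intervalIntegral.norm_integral_le_of_norm_le zero_le_one
      (Eventually.of_forall fun s hs => ?_)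
      ((continuous_const.mul (continuous_cutoff n)).intervalIntegrable _ _)
    rw [norm_mul, Real.norm_of_nonneg (cutoff_nonneg n s), mul_comm]
    exact mul_le_mul_of_nonneg_right (hM s (Ioc_subset_Icc_self hs) y hy) (cutoff_nonneg n s)
  have hgb : ∀ n, ∀ s ∈ Icc (0 : ℝ) 1, ∀ y ∈ Icc (0 : ℝ) 1, |g n s y| ≤ M + M := by
    intro n s hs y hy
    simp only [hg]
    rw [abs_mul, abs_mul, abs_of_nonneg (cutoff_nonneg n y), abs_of_nonneg (cutoff_nonneg n s)]
    have h1 : |f s y - m n y| ≤ M + M :=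
      (abs_sub _ _).trans (add_le_add (hM s hs y hy) (hmb n y hy))
    have h2 : cutoff n s * |f s y - m n y| ≤ |f s y - m n y| :=
      mul_le_of_le_one_left (abs_nonneg _) (cutoff_le_one n s)
    exact (mul_le_of_le_one_left (mul_nonneg (cutoff_nonneg n s) (abs_nonneg _))
      (cutoff_le_one n y)).trans (h2.trans h1)
  have hWlim : Tendsto W atTop (𝓝 1) := by
    have := tendsto_intervalIntegral_of_bounded (g := cutoff) (g₀ := fun _ => 1) (M := 1)
      (right_mem_Icc.2 zero_le_one) continuous_cutoff
      (fun n s _ => by rw [abs_of_nonneg (cutoff_nonneg n s)]; exact cutoff_le_one n s)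
      (fun s hs => tendsto_cutoff hs)
    simpa using this
  have hmlim : ∀ y ∈ Icc (0 : ℝ) 1, Tendsto (fun n => m n y) atTop (𝓝 0) := by
    intro y hy
    have h1 := tendsto_intervalIntegral_of_bounded (g := fun n s => cutoff n s * f s y)
      (g₀ := fun s => f s y) (M := M)
      (right_mem_Icc.2 zero_le_one) (fun n => (continuous_cutoff n).mul (hfx y))
      (fun n s hs => by
        rw [abs_mul, abs_of_nonneg (cutoff_nonneg n s)]
        exact (mul_le_of_le_one_left (abs_nonneg _) (cutoff_le_one n s)).trans (hM s hs y hy))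
      (fun s hs => by simpa using (tendsto_cutoff hs).mul_const (f s y))
    have := h1.div hWlim one_ne_zero
    rwa [hmean, zero_div] at this
  have hglim : ∀ s ∈ Ioo (0 : ℝ) 1, ∀ y ∈ Ioo (0 : ℝ) 1,
      Tendsto (fun n => g n s y) atTop (𝓝 (f s y)) := by
    intro s hs y hy
    have := (tendsto_cutoff hy).mul ((tendsto_cutoff hs).mul
      ((hmlim y (Ioo_subset_Icc_self hy)).const_sub (f s y)))
    simpa using this
  have key : ∀ n, ∫ x in openUnitSquare, c x * g n (x 0) (x 1) =
      - ∫ x in openUnitSquare, G x 0 * ∫ s in (0 : ℝ)..x 0, g n s (x 1) := by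
    intro n
    refine hG.integral_primitive_of_support hc hG0 (hgc n) (hgmean n) (δ := 1 / ((n : ℝ) + 3))
      (by positivity) fun s y hne => ?_
    exact ⟨mem_Icc_of_cutoff_ne_zero (left_ne_zero_of_mul (right_ne_zero_of_mul hne)),
      mem_Icc_of_cutoff_ne_zero (left_ne_zero_of_mul hne)⟩
  have hmeas := isOpen_openUnitSquare.measurableSet
  have L1 : Tendsto (fun n => ∫ x in openUnitSquare, c x * g n (x 0) (x 1)) atTop
      (𝓝 (∫ x in openUnitSquare, c x * f (x 0) (x 1))) := by
    refine tendsto_integral_of_dominated_convergence (fun x => ‖c x‖ * (M + M)) (fun n => ?_)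
      (hc.norm.mul_const _) (fun n => ?_) ?_
    · refine hc.aestronglyMeasurable.mul (Continuous.aestronglyMeasurable ?_)
      exact (hgc n).comp (f := fun x : EuclideanSpace ℝ (Fin 2) => (x 0, x 1)) (by fun_prop)
    · filter_upwards [ae_restrict_mem hmeas] with x hx
      rw [norm_mul]
      gcongr
      exact hgb n _ (Ioo_subset_Icc_self (hx 0)) _ (Ioo_subset_Icc_self (hx 1))
    · filter_upwards [ae_restrict_mem hmeas] with x hx
      exact (hglim _ (hx 0) _ (hx 1)).const_mul _
  have L2 : Tendsto (fun n => ∫ x in openUnitSquare, G x 0 * ∫ s in (0 : ℝ)..x 0, g n s (x 1))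
      atTop (𝓝 (∫ x in openUnitSquare, G x 0 * ∫ s in (0 : ℝ)..x 0, f s (x 1))) := by
    refine tendsto_integral_of_dominated_convergence (fun x => ‖G x 0‖ * (M + M)) (fun n => ?_)
      (hG0.norm.mul_const _) (fun n => ?_) ?_
    · refine hG0.aestronglyMeasurable.mul (Continuous.aestronglyMeasurable ?_)
      exact intervalIntegral.continuous_parametric_intervalIntegral_of_continuous
        (f := fun (x : EuclideanSpace ℝ (Fin 2)) s => g n s (x 1)) (s := fun x => x 0)
        ((hgc n).comp (f := fun p : EuclideanSpace ℝ (Fin 2) × ℝ => (p.2, p.1 1)) (by fun_prop))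
        (by fun_prop)
    · filter_upwards [ae_restrict_mem hmeas] with x hx
      rw [norm_mul]
      gcongr
      have h0 := Ioo_subset_Icc_self (hx 0)
      have hM0 : 0 ≤ M + M := (abs_nonneg _).trans (hgb n _ h0 _ (Ioo_subset_Icc_self (hx 1)))
      refine (intervalIntegral.norm_integral_le_of_norm_le_const (C := M + M) fun s hs => ?_).trans ?_
      · rw [uIoc_of_le h0.1] at hs
        exact hgb n s ⟨hs.1.le, hs.2.trans h0.2⟩ _ (Ioo_subset_Icc_self (hx 1))
      · rw [sub_zero, abs_of_nonneg h0.1]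
        exact mul_le_of_le_one_right hM0 h0.2
    · filter_upwards [ae_restrict_mem hmeas] with x hx
      refine Tendsto.const_mul _ ?_
      exact tendsto_intervalIntegral_of_bounded (Ioo_subset_Icc_self (hx 0)) (fun n => hgx n _)
        (fun n s hs => hgb n s hs _ (Ioo_subset_Icc_self (hx 1)))
        (fun s hs => hglim s hs _ (hx 1))
  refine tendsto_nhds_unique L1 ?_
  simp only [key]
  exact L2.neg

end Primitive

end CopulaStein

/-! ### The bound on the primitive, Cauchy-Schwarz, uniform laws and densities -/

namespace CopulaStein

/-- The primitive of a centred `1`-Lipschitz function on `[0,1]` is at most `1/8`. -/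
theorem abs_integral_sub_mean_le {h : ℝ → ℝ} (hh : LipschitzWith 1 h) {x : ℝ}
    (hx : x ∈ Icc (0 : ℝ) 1) :
    |∫ s in (0 : ℝ)..x, (h s - ∫ t in (0 : ℝ)..1, h t)| ≤ 1 / 8 := by
  have hi : ∀ a b, IntervalIntegrable h volume a b :=
    fun a b => hh.continuous.intervalIntegrable a b
  have hlip : ∀ s, |h s - h x| ≤ |s - x| := fun s => by
    simpa only [Real.dist_eq, NNReal.coe_one, one_mul] using hh.dist_le_mul s x
  -- Write `∫₀ˣ (h - mean) = (1-x) ∫₀ˣ (h - h x) - x ∫ₓ¹ (h - h x)`. The Lipschitz bounds on the two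
  -- pieces add up to `(1-x) x²/2 + x (1-x)²/2 = x (1-x)/2 ≤ 1/8`.
  have hL : |∫ s in (0 : ℝ)..x, (h s - h x)| ≤ x ^ 2 / 2 := by
    have : ∫ s in (0 : ℝ)..x, (x - s) = x ^ 2 / 2 := by
      rw [intervalIntegral.integral_sub intervalIntegrable_const intervalIntegral.intervalIntegrable_id,
        intervalIntegral.integral_const, integral_id, smul_eq_mul]
      ring
    rw [← this, ← Real.norm_eq_abs]
    refine intervalIntegral.norm_integral_le_of_norm_le hx.1
      (Filter.Eventually.of_forall fun s hs => ?_) (Continuous.intervalIntegrable (by fun_prop) _ _)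
    refine (hlip s).trans_eq ?_
    rw [abs_sub_comm, abs_of_nonneg (by linarith [hs.2])]
  have hR : |∫ s in x..1, (h s - h x)| ≤ (1 - x) ^ 2 / 2 := by
    have : ∫ s in x..1, (s - x) = (1 - x) ^ 2 / 2 := by
      rw [intervalIntegral.integral_sub intervalIntegral.intervalIntegrable_id intervalIntegrable_const,
        intervalIntegral.integral_const, integral_id, smul_eq_mul]
      ring
    rw [← this, ← Real.norm_eq_abs]
    refine intervalIntegral.norm_integral_le_of_norm_le hx.2
      (Filter.Eventually.of_forall fun s hs => ?_) (Continuous.intervalIntegrable (by fun_prop) _ _)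
    refine (hlip s).trans_eq ?_
    rw [abs_of_nonneg (by linarith [hs.1])]
  rw [intervalIntegral.integral_sub (hi _ _) intervalIntegrable_const,
    intervalIntegral.integral_const, smul_eq_mul] at hL hR ⊢
  rw [← intervalIntegral.integral_add_adjacent_intervals (hi 0 x) (hi x 1)]
  rw [abs_le] at hL hR ⊢
  have h0 := hx.1
  have h1 : 0 ≤ 1 - x := by linarith [hx.2]
  have hq : x * (1 - x) ≤ 1 / 4 := by nlinarith [sq_nonneg (x - 1 / 2)]
  constructor
  · nlinarith [mul_le_mul_of_nonneg_left hL.1 h1, mul_le_mul_of_nonneg_left hR.2 h0]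
  · nlinarith [mul_le_mul_of_nonneg_left hL.2 h1, mul_le_mul_of_nonneg_left hR.1 h0]

theorem volume_openUnitSquare : volume openUnitSquare = 1 := by
  have h : openUnitSquare = WithLp.ofLp ⁻¹' (Set.univ.pi fun _ : Fin 2 => Ioo (0 : ℝ) 1) := by
    ext x
    rw [mem_preimage, mem_univ_pi]
    rfl
  rw [h, (PiLp.volume_preserving_ofLp (Fin 2)).measure_preimage
    (MeasurableSet.univ_pi fun _ => measurableSet_Ioo).nullMeasurableSet, volume_pi_pi]
  simp

/-- The Cauchy-Schwarz inequality against the constant function `1` on the unit square. -/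
theorem lintegral_partial_le (G : EuclideanSpace ℝ (Fin 2) → EuclideanSpace ℝ (Fin 2)) (i : Fin 2)
    (hG : AEMeasurable (fun x => G x i) (volume.restrict openUnitSquare)) :
    ∫⁻ x in openUnitSquare, ‖G x i‖ₑ ≤
      (∫⁻ x in closedUnitSquare, ‖G x‖ₑ ^ 2) ^ (1 / 2 : ℝ) := by
  have h := ENNReal.lintegral_mul_le_Lp_mul_Lq (volume.restrict openUnitSquare)
    Real.HolderConjugate.two_two hG.enorm (aemeasurable_const (b := (1 : ℝ≥0∞)))
  simp only [Pi.mul_apply, mul_one, ENNReal.one_rpow, lintegral_const,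
    Measure.restrict_apply_univ, volume_openUnitSquare] at h
  refine h.trans (ENNReal.rpow_le_rpow ?_ (by norm_num))
  refine (lintegral_mono fun x => ?_).trans
    (lintegral_mono_set fun x hx i => Ioo_subset_Icc_self (hx i))
  rw [← ENNReal.rpow_natCast]
  refine ENNReal.rpow_le_rpow ?_ (by norm_num)
  rw [enorm_le_iff_norm_le]
  exact PiLp.norm_apply_le _ i

theorem _root_.MeasureTheory.pdf.IsUniform.map_eq_restrict_unitInterval {Ω : Type*}
    [MeasurableSpace Ω] {P : Measure Ω} {X : Ω → ℝ} (h : pdf.IsUniform X (Icc (0 : ℝ) 1) P volume) :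
    P.map X = volume.restrict (Icc (0 : ℝ) 1) := by
  unfold pdf.IsUniform at h
  rw [h, ProbabilityTheory.cond]
  simp

theorem _root_.MeasureTheory.pdf.IsUniform.aemeasurable_unitInterval {Ω : Type*}
    [MeasurableSpace Ω] {P : Measure Ω} {X : Ω → ℝ} (h : pdf.IsUniform X (Icc (0 : ℝ) 1) P volume) :
    AEMeasurable X P :=
  h.aemeasurable (by simp) (by simp)

theorem _root_.MeasureTheory.pdf.IsUniform.ae_mem_Ioo {Ω : Type*}
    [MeasurableSpace Ω] {P : Measure Ω} {X : Ω → ℝ} (h : pdf.IsUniform X (Icc (0 : ℝ) 1) P volume) :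
    ∀ᵐ ω ∂P, X ω ∈ Ioo (0 : ℝ) 1 := by
  refine ae_of_ae_map h.aemeasurable_unitInterval ?_
  rw [h.map_eq_restrict_unitInterval, ← restrict_Ioo_eq_restrict_Icc]
  exact ae_restrict_mem measurableSet_Ioo

theorem _root_.MeasureTheory.pdf.IsUniform.integral_comp {Ω : Type*}
    [MeasurableSpace Ω] {P : Measure Ω} {X : Ω → ℝ} (h : pdf.IsUniform X (Icc (0 : ℝ) 1) P volume)
    {g : ℝ → ℝ} (hg : Continuous g) : ∫ ω, g (X ω) ∂P = ∫ s in (0 : ℝ)..1, g s := by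
  rw [← integral_map h.aemeasurable_unitInterval hg.aestronglyMeasurable,
    h.map_eq_restrict_unitInterval, intervalIntegral.integral_of_le zero_le_one,
    integral_Icc_eq_integral_Ioc]

/-- The expectation of a continuous function of two independent uniform variables. -/
theorem integral_indep_uniform {Ω : Type*} [MeasurableSpace Ω] {P : Measure Ω}
    [IsProbabilityMeasure P] {X Y : Ω → ℝ} (hX : pdf.IsUniform X (Icc (0 : ℝ) 1) P volume)
    (hY : pdf.IsUniform Y (Icc (0 : ℝ) 1) P volume) (hXY : IndepFun X Y P)
    {g : ℝ × ℝ → ℝ} (hg : Continuous g) :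
    ∫ ω, g (X ω, Y ω) ∂P = ∫ y in (0 : ℝ)..1, ∫ x in (0 : ℝ)..1, g (x, y) := by
  have hXm := hX.aemeasurable_unitInterval
  have hYm := hY.aemeasurable_unitInterval
  rw [← integral_map (φ := fun ω => (X ω, Y ω)) (hXm.prodMk hYm) hg.aestronglyMeasurable,
    (indepFun_iff_map_prod_eq_prod_map_map hXm hYm).1 hXY, hX.map_eq_restrict_unitInterval,
    hY.map_eq_restrict_unitInterval, integral_prod_symm]
  · simp only [intervalIntegral.integral_of_le zero_le_one, integral_Icc_eq_integral_Ioc]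
  · rw [Measure.prod_restrict]
    exact hg.continuousOn.integrableOn_compact (isCompact_Icc.prod isCompact_Icc)

variable {Ω : Type*} [MeasurableSpace Ω] {P : Measure Ω}
  {c : EuclideanSpace ℝ (Fin 2) → ℝ} {X : Ω → EuclideanSpace ℝ (Fin 2)}

theorem IsDensityOf.integrable [IsProbabilityMeasure P] (hc : IsDensityOf c X P) :
    Integrable c := by
  refine ⟨hc.aemeasurable.aestronglyMeasurable, ?_⟩
  rw [hasFiniteIntegral_iff_ofReal hc.nonneg, ← setLIntegral_univ,
    ← withDensity_apply _ MeasurableSet.univ, ← hc.map_eq]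
  exact measure_lt_top _ _

/-- The law is carried by `s`, so its density may be restricted to `s`. This turns an expectation
into an integral over the open square, where the weak gradient is available. -/
theorem IsDensityOf.integral_map (hc : IsDensityOf c X P)
    {s : Set (EuclideanSpace ℝ (Fin 2))} (hs : MeasurableSet s) (hXs : ∀ᵐ x ∂(P.map X), x ∈ s)
    (g : EuclideanSpace ℝ (Fin 2) → ℝ) : ∫ x, g x ∂(P.map X) = ∫ x in s, c x * g x := by
  rw [← Measure.restrict_eq_self_of_ae_mem hXs, hc.map_eq, restrict_withDensity hs,
    integral_withDensity_eq_integral_toReal_smul₀ hc.aemeasurable.ennreal_ofReal.restrict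
      (Filter.Eventually.of_forall fun _ => ENNReal.ofReal_lt_top)]
  refine integral_congr_ae ?_
  filter_upwards [ae_restrict_of_ae hc.nonneg] with x hx
  rw [ENNReal.toReal_ofReal hx, smul_eq_mul]

end CopulaStein

/-! ### The Wasserstein bound -/

theorem mainTheorem10
    {Ω Ω' : Type*} [MeasurableSpace Ω] [MeasurableSpace Ω']
    (P : Measure Ω) [IsProbabilityMeasure P] (P' : Measure Ω') [IsProbabilityMeasure P']
    (V₁ V₂ : Ω → ℝ) (U₁ U₂ : Ω' → ℝ)
    (hV₁ : pdf.IsUniform V₁ (Icc (0 : ℝ) 1) P volume)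
    (hV₂ : pdf.IsUniform V₂ (Icc (0 : ℝ) 1) P volume)
    (hU₁ : pdf.IsUniform U₁ (Icc (0 : ℝ) 1) P' volume)
    (hU₂ : pdf.IsUniform U₂ (Icc (0 : ℝ) 1) P' volume)
    (hU : IndepFun U₁ U₂ P')
    (c : EuclideanSpace ℝ (Fin 2) → ℝ)
    (hc : CopulaStein.IsDensityOf c (fun ω => !₂[V₁ ω, V₂ ω]) P)
    (gradc : EuclideanSpace ℝ (Fin 2) → EuclideanSpace ℝ (Fin 2))
    (hgrad : CopulaStein.HasWeakGradientOn c gradc CopulaStein.openUnitSquare) :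
    CopulaStein.wassersteinDist
        (P.map (fun ω => !₂[V₁ ω, V₂ ω])) (P'.map (fun ω => !₂[U₁ ω, U₂ ω])) ≤
      ENNReal.ofReal (2 / Real.pi ^ 2) *
        (∫⁻ x in CopulaStein.closedUnitSquare, ‖gradc x‖ₑ ^ 2) ^ (1 / 2 : ℝ) := by
  open CopulaStein in
  set R := (∫⁻ x in closedUnitSquare, ‖gradc x‖ₑ ^ 2) ^ (1 / 2 : ℝ)
  -- Finiteness of `R` is what makes the first partial derivative integrable up to the boundary,
  -- rather than only locally.
  rcases eq_or_ne R ∞ with hRtop | hRtop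
  · rw [hRtop, ENNReal.mul_top (by simp [Real.pi_pos])]
    exact le_top
  have hmeas := isOpen_openUnitSquare.measurableSet
  have hGm : AEStronglyMeasurable (fun x => gradc x 0) (volume.restrict openUnitSquare) :=
    (EuclideanSpace.proj (𝕜 := ℝ) (0 : Fin 2)).continuous.comp_aestronglyMeasurable
      hgrad.locallyIntegrableOn_gradient.aestronglyMeasurable
  have hGle := lintegral_partial_le gradc 0 hGm.aemeasurable
  have hG0 : IntegrableOn (fun x => gradc x 0) openUnitSquare :=
    ⟨hGm, hGle.trans_lt hRtop.lt_top⟩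
  have hVm : AEMeasurable (fun ω => !₂[V₁ ω, V₂ ω]) P :=
    (by fun_prop : Continuous fun p : ℝ × ℝ => !₂[p.1, p.2]).measurable.comp_aemeasurable
      (hV₁.aemeasurable_unitInterval.prodMk hV₂.aemeasurable_unitInterval)
  have hUm : AEMeasurable (fun ω => !₂[U₁ ω, U₂ ω]) P' :=
    (by fun_prop : Continuous fun p : ℝ × ℝ => !₂[p.1, p.2]).measurable.comp_aemeasurable
      (hU₁.aemeasurable_unitInterval.prodMk hU₂.aemeasurable_unitInterval)
  have hVmem : ∀ᵐ x ∂(P.map fun ω => !₂[V₁ ω, V₂ ω]), x ∈ openUnitSquare := by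
    refine (ae_map_iff hVm hmeas).2 ?_
    filter_upwards [hV₁.ae_mem_Ioo, hV₂.ae_mem_Ioo] with ω h1 h2 i
    fin_cases i
    exacts [h1, h2]
  have hprob : IsProbabilityMeasure (P.map fun ω => !₂[V₁ ω, V₂ ω]) :=
    Measure.isProbabilityMeasure_map hVm
  have hint : ∀ g : EuclideanSpace ℝ (Fin 2) → ℝ, Continuous g →
      Integrable g (P.map fun ω => !₂[V₁ ω, V₂ ω]) := by
    intro g hg
    -- The law lives on a compact square, so continuity alone gives integrability.
    rw [← Measure.restrict_eq_self_of_ae_mem (s := {x | ∀ i, x i ∈ Icc (0 : ℝ) 1})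
      (hVmem.mono fun x hx i => Ioo_subset_Icc_self (hx i))]
    exact hg.continuousOn.integrableOn_compact (isCompact_setOf_forall_mem_Icc 2 0 1)
  refine iSup₂_le fun h hh => ?_
  set H : ℝ → ℝ → ℝ := fun s y => h !₂[s, y] with hH
  have hHc : Continuous fun p : ℝ × ℝ => H p.1 p.2 :=
    hh.continuous.comp (by fun_prop : Continuous fun p : ℝ × ℝ => !₂[p.1, p.2])
  have hHx : ∀ y, LipschitzWith 1 fun s => H s y := fun y =>
    LipschitzWith.of_dist_le_mul fun s t => by
      refine (hh.dist_le_mul _ _).trans_eq ?_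
      simp [EuclideanSpace.dist_eq, Real.sqrt_sq_eq_abs, Real.dist_eq]
  set m : ℝ → ℝ := fun y => ∫ s in (0 : ℝ)..1, H s y with hm
  have hmc : Continuous m :=
    intervalIntegral.continuous_parametric_intervalIntegral_of_continuous'
      (f := fun y s => H s y) (hHc.comp continuous_swap) 0 1
  have hfc : Continuous fun p : ℝ × ℝ => H p.1 p.2 - m p.2 := hHc.sub (hmc.comp continuous_snd)
  have hfmean : ∀ y, ∫ s in (0 : ℝ)..1, (H s y - m y) = 0 := fun y => by
    rw [intervalIntegral.integral_sub ((hHx y).continuous.intervalIntegrable _ _)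
      intervalIntegrable_const]
    simp [hm]
  have key := hgrad.integral_primitive hc.integrable.integrableOn hG0 hfc hfmean
  have hEU : ∫ x, h x ∂(P'.map fun ω => !₂[U₁ ω, U₂ ω]) = ∫ y in (0 : ℝ)..1, m y := by
    rw [integral_map hUm hh.continuous.aestronglyMeasurable]
    exact integral_indep_uniform hU₁ hU₂ hU hHc
  have hEV : ∫ x, m (x 1) ∂(P.map fun ω => !₂[V₁ ω, V₂ ω]) = ∫ y in (0 : ℝ)..1, m y := by
    rw [integral_map hVm (by fun_prop : Continuous fun x : EuclideanSpace ℝ (Fin 2) =>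
      m (x 1)).aestronglyMeasurable]
    exact hV₂.integral_comp hmc
  have hdiff : ∫ x, h x ∂(P.map fun ω => !₂[V₁ ω, V₂ ω]) -
      ∫ x, h x ∂(P'.map fun ω => !₂[U₁ ω, U₂ ω]) =
        - ∫ x in openUnitSquare, gradc x 0 * ∫ s in (0 : ℝ)..x 0, (H s (x 1) - m (x 1)) := by
    -- The uniformity of `V₂` enters here: `E h(U)` is exchanged for `E m(V₂)`, leaving one integral
    -- against the law of `V`.
    rw [hEU, ← hEV, ← integral_sub (hint _ hh.continuous) (hint _ (by fun_prop)),
      hc.integral_map hmeas hVmem, ← key]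
    refine integral_congr_ae (Filter.Eventually.of_forall fun x => ?_)
    simp only [hH]
    congr 3
    ext i
    fin_cases i <;> rfl
  have hbound : ‖∫ x in openUnitSquare, gradc x 0 * ∫ s in (0 : ℝ)..x 0, (H s (x 1) - m (x 1))‖ₑ ≤
      ENNReal.ofReal (1 / 8) * R := by
    refine (enorm_integral_le_lintegral_enorm _).trans ?_
    calc _ ≤ ∫⁻ x in openUnitSquare, ENNReal.ofReal (1 / 8) * ‖gradc x 0‖ₑ := by
          refine setLIntegral_mono' hmeas fun x hx => ?_
          rw [enorm_mul, mul_comm]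
          gcongr
          rw [← ofReal_norm]
          exact ENNReal.ofReal_le_ofReal
            (abs_integral_sub_mean_le (hHx (x 1)) (Ioo_subset_Icc_self (hx 0)))
      _ = ENNReal.ofReal (1 / 8) * ∫⁻ x in openUnitSquare, ‖gradc x 0‖ₑ :=
          lintegral_const_mul' _ _ ENNReal.ofReal_ne_top
      _ ≤ _ := by gcongr
  rw [hdiff, abs_neg, ← Real.norm_eq_abs, ofReal_norm]
  refine hbound.trans ?_
  refine mul_le_mul_left (ENNReal.ofReal_le_ofReal ?_) R
  -- `1/8 ≤ 2/π²` amounts to `π² ≤ 16`, that is `π ≤ 4`.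
  rw [div_le_div_iff₀ (by norm_num) (by positivity)]
  nlinarith [Real.pi_le_four, Real.pi_pos]
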